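/- All rings are associative with identity, and "module" means unital left module unless "right" is said. Let $R$ be a ring. An $R$-module $M$ is Gorenstein projective if there is an exact sequence of projective $R$-modules $\cdots\to P_1\to P_0\to P^0\to P^1\to\cdots$ that stays exact under $\operatorname{Hom}_R(-,Q)$ for every projective $R$-module $Q$ and satisfies $M\cong\operatorname{Im}(P_0\to P^0)$. The Gorenstein projective dimension $\operatorname{Gpd}_R(M)\in\mathbb N\cup\{\infty\}$ is the least $m$ such that there is an exact sequence $0\to G_m\to\cdots\to G_0\to M\to 0$ with all $G_i$ Gorenstein projective ($\infty$ if there is none), and the left Gorenstein global dimension of $R$ is $\mathrm{lG.gldim}(R)=\sup\{\operatorname{Gpd}_R(M)\mid M \text{ an } R\text{-module}\}$. Proposition. Let $R$ be a semi-primary ring with radical $N$, that is, $N$ is a nilpotent two-sided ideal of $R$ such that the ring $R/N$ is semisimple (Artinian). Suppose that $\mathrm{lG.gldim}(R)<\infty$ and let $n>0$ be an integer. The following are equivalent: 1. $\mathrm{lG.gldim}(R)<n$; 2. $\operatorname{Ext}_R^n(I,R/N)=0$ for every injective $R$-module $I$; 3. $\operatorname{Ext}_R^n(I,C)=0$ for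 every injective $R$-module $I$ and every simple $R$-module $C$; 4. $\operatorname{Tor}^R_n(R/N,I)=0$ for every injective $R$-module $I$, where $R/N$ is regarded as a right $R$-module; 5. $\operatorname{Tor}^R_n(C,I)=0$ for every injective $R$-module $I$ and every simple right $R$-module $C$; 6. $\operatorname{Ext}_R^n(R/N,P)=0$ for every projective $R$-module $P$; 7. $\operatorname{Ext}_R^n(C,P)=0$ for every projective $R$-module $P$ and every simple $R$-module $C$. -/

import Mathlib

open CategoryTheory

universe u

section Gorenstein

variable {R : Type u} [Ring R]

/-- A left `R`-module `M` is Gorenstein projective if there is an exact sequence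
`⋯ → P (-1) → P 0 → P 1 → ⋯` of projective left `R`-modules which stays exact under `Hom(-, Q)` for
every projective left `R`-module `Q`, and such that `M` is isomorphic to the image of one (fixed)
of its maps. -/
def IsGorensteinProjective (M : ModuleCat.{u} R) : Prop :=
  ∃ (P : ℤ → ModuleCat.{u} R) (d : ∀ i : ℤ, P i →ₗ[R] P (i + 1)),
    (∀ i, Module.Projective R (P i)) ∧
    (∀ i, Function.Exact (d i) (d (i + 1))) ∧
    (∀ Q : ModuleCat.{u} R, Module.Projective R Q → ∀ i,
      Function.Exact
        (fun f : P (i + 1 + 1) →ₗ[R] Q => f ∘ₗ d (i + 1))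
        (fun f : P (i + 1) →ₗ[R] Q => f ∘ₗ d i)) ∧
    Nonempty (M ≃ₗ[R] LinearMap.range (d 0))

/-- `HasGorensteinProjectiveResolution n M`: there is an exact sequence
`0 → G n → ⋯ → G 1 → G 0 → M → 0` with all `G i` Gorenstein projective. For positive length the
sequence is cut at the kernel `K` of `G 0 → M`. -/
def HasGorensteinProjectiveResolution : ℕ → ModuleCat.{u} R → Prop
  | 0, M => IsGorensteinProjective M
  | n + 1, M => ∃ (K G : ModuleCat.{u} R) (i : K →ₗ[R] G) (p : G →ₗ[R] M),
      Function.Injective i ∧ Function.Exact i p ∧ Function.Surjective p ∧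
      IsGorensteinProjective G ∧ HasGorensteinProjectiveResolution n K

/-- The Gorenstein projective dimension of a left module: the least length of a resolution by
Gorenstein projective modules, and `⊤` if there is none of finite length. -/
noncomputable def gorensteinProjectiveDim (M : ModuleCat.{u} R) : ℕ∞ :=
  ⨅ (n : ℕ) (_ : HasGorensteinProjectiveResolution n M), (n : ℕ∞)

variable (R) in
/-- The left Gorenstein global dimension of `R`: the supremum of the Gorenstein projective
dimensions of all left `R`-modules. -/
noncomputable def leftGorensteinGlobalDim : ℕ∞ :=
  ⨆ M : ModuleCat.{u} R, gorensteinProjectiveDim M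

end Gorenstein

section Tor

open TensorProduct

variable {R : Type u} [Ring R]

/-- The subgroup of `C ⊗ M` (tensor product over `ℤ`) generated by all `cr ⊗ m - c ⊗ rm`. -/
def balancedRelations (C : ModuleCat.{u} Rᵐᵒᵖ) (M : ModuleCat.{u} R) : AddSubgroup (C ⊗[ℤ] M) :=
  AddSubgroup.closure {x | ∃ (c : C) (r : R) (m : M),
    x = (MulOpposite.op r • c) ⊗ₜ[ℤ] m - c ⊗ₜ[ℤ] (r • m)}

/-- The tensor product over `R` of a right `R`-module `C` and a left `R`-module `M`. -/
abbrev BalancedTensor (C : ModuleCat.{u} Rᵐᵒᵖ) (M : ModuleCat.{u} R) : Type u :=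
  (C ⊗[ℤ] M) ⧸ balancedRelations C M

/-- The map `id ⊗ f` of tensor products over `ℤ`. -/
noncomputable def intTensorMap (C : ModuleCat.{u} Rᵐᵒᵖ) {M M' : ModuleCat.{u} R} (f : M ⟶ M') :
    C ⊗[ℤ] M →+ C ⊗[ℤ] M' :=
  (TensorProduct.map LinearMap.id f.hom.toAddMonoidHom.toIntLinearMap).toAddMonoidHom

@[simp]
theorem intTensorMap_tmul (C : ModuleCat.{u} Rᵐᵒᵖ) {M M' : ModuleCat.{u} R} (f : M ⟶ M')
    (c : C) (m : M) : intTensorMap C f (c ⊗ₜ[ℤ] m) = c ⊗ₜ[ℤ] (f.hom m) := rfl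

theorem balancedRelations_le_comap (C : ModuleCat.{u} Rᵐᵒᵖ) {M M' : ModuleCat.{u} R}
    (f : M ⟶ M') :
    balancedRelations C M ≤ (balancedRelations C M').comap (intTensorMap C f) := by
  rw [balancedRelations, AddSubgroup.closure_le]
  rintro x ⟨c, r, m, rfl⟩
  apply AddSubgroup.subset_closure
  exact ⟨c, r, f.hom m, by rw [map_sub, intTensorMap_tmul, intTensorMap_tmul, map_smul]⟩

/-- The map `id ⊗ f` of tensor products over `R`. -/
noncomputable def balancedTensorMap (C : ModuleCat.{u} Rᵐᵒᵖ) {M M' : ModuleCat.{u} R}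
    (f : M ⟶ M') : BalancedTensor C M →+ BalancedTensor C M' :=
  QuotientAddGroup.map _ _ (intTensorMap C f) (balancedRelations_le_comap C f)

theorem balancedTensor_hom_ext {C : ModuleCat.{u} Rᵐᵒᵖ} {M : ModuleCat.{u} R}
    {A : Type*} [AddCommGroup A] {f g : BalancedTensor C M →+ A}
    (h : ∀ (c : C) (m : M), f (QuotientAddGroup.mk (c ⊗ₜ[ℤ] m)) =
      g (QuotientAddGroup.mk (c ⊗ₜ[ℤ] m))) : f = g := by
  refine DFunLike.ext f g fun x => ?_
  induction x using QuotientAddGroup.induction_on with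
  | H x =>
    induction x using TensorProduct.induction_on with
    | zero => exact (map_zero f).trans (map_zero g).symm
    | tmul c m => exact h c m
    | add x y hx hy => rw [QuotientAddGroup.mk_add, map_add, map_add, hx, hy]

/-- The functor `C ⊗_R -` from left `R`-modules to abelian groups, for a right `R`-module `C`. -/
noncomputable def balancedTensorFunctor (C : ModuleCat.{u} Rᵐᵒᵖ) :
    ModuleCat.{u} R ⥤ AddCommGrpCat.{u} where
  obj M := AddCommGrpCat.of (BalancedTensor C M)
  map f := AddCommGrpCat.ofHom (balancedTensorMap C f)
  map_id M := by
    ext1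
    exact balancedTensor_hom_ext fun _ _ => rfl
  map_comp f g := by
    ext1
    exact balancedTensor_hom_ext fun _ _ => rfl

instance (C : ModuleCat.{u} Rᵐᵒᵖ) : (balancedTensorFunctor C).Additive where
  map_add {M M' f g} := by
    ext1
    refine balancedTensor_hom_ext fun c m => ?_
    exact congrArg (QuotientAddGroup.mk (s := balancedRelations C M'))
      (TensorProduct.tmul_add c (f.hom m) (g.hom m))

/-- `Tor_n^R(C, M)` for a right `R`-module `C` and a left `R`-module `M`: the `n`-th left derived
functor of `C ⊗_R -`, evaluated at `M`. -/
noncomputable def torGroup (n : ℕ) (C : ModuleCat.{u} Rᵐᵒᵖ) (M : ModuleCat.{u} R) :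
    AddCommGrpCat.{u} :=
  ((balancedTensorFunctor C).leftDerived n).obj M

/-- `R ⧸ N` as a right `R`-module, for a two-sided ideal `N`. -/
noncomputable def rightQuotient (N : Ideal R) [N.IsTwoSided] : ModuleCat.{u} Rᵐᵒᵖ :=
  letI : Module Rᵐᵒᵖ (R ⧸ N) := Module.compHom (R ⧸ N) (RingHom.op (Ideal.Quotient.mk N))
  ModuleCat.of Rᵐᵒᵖ (R ⧸ N)

end Tor

/-!
The argument has two halves: over any ring of finite Gorenstein global dimension, that dimension is
measured by the injective dimensions of projective modules, and also by the projective dimensions of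
injective modules; over a semiprimary ring these can be tested in a single degree on simple modules.

For the first half, a module `M` with a Gorenstein projective resolution of length `m` sits in a
short exact sequence `0 → M → H → W → 0` with `H` of projective dimension at most `m` and `W`
Gorenstein projective (`HasGorensteinProjectiveResolution.exists_shortExact`). If `M` is injective,
the sequence splits and the projective dimension of `M` is at most `m`. If `Ext` from `M` to
projectives vanishes in positive degrees, then `H` is projective, so `M` is a syzygy of a module
of the same kind; splicing shows that `M` is Gorenstein projective. Consequently, the Gorenstein
global dimension, if finite, is less than `n` iff `Ext^n(-, P) = 0` for all projective `P`
(`leftGorensteinGlobalDim_lt_iff_forall_projective`), and also iff `Ext^n(I, -) = 0` for all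
injective `I` (`leftGorensteinGlobalDim_lt_iff_forall_injective`). In the latter equivalence one
embeds modules in injective ones and uses that `Ext^i(-, P)` vanishes for large `i`.

For the second half, let `N` be nilpotent with `R ⧸ N` semisimple. The filtration by the powers of
`N` shows that vanishing of `Ext^n` in either variable may be tested on modules killed by `N`
(`of_isTorsionBySet_of_isNilpotent`). Such modules are semisimple, so they are direct sums of simple
modules, and retracts of products of simple modules, of copies of the character dual of `R ⧸ N`, or
of character duals of simple right modules. Since `Ext^n` turns sums in the first variable and
products in the second into products, vanishing on these special modules suffices. The conditions on
`Tor` are of this form because `Tor_n(C, I) = 0` iff `Ext^n(I, Hom_ℤ(C, ℚ/ℤ)) = 0`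
(`subsingleton_torGroup_iff_subsingleton_ext`).
-/

/-! ### Vanishing of Ext -/

section Ext

open Abelian Limits

universe v w

variable {C : Type u} [Category.{v} C] [Abelian C]

theorem CategoryTheory.exists_shortExact_projective [EnoughProjectives C] (M : C) :
    ∃ (K P : C) (i : K ⟶ P) (p : P ⟶ M) (w : i ≫ p = 0),
      (ShortComplex.mk i p w).ShortExact ∧ Projective P :=
  ⟨_, _, _, _, kernel.condition (Projective.π M),
    { exact := ShortComplex.exact_of_f_is_kernel _ (kernelIsKernel (Projective.π M)) },
    inferInstance⟩

theorem CategoryTheory.exists_shortExact_injective [EnoughInjectives C] (M : C) :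
    ∃ (I L : C) (i : M ⟶ I) (p : I ⟶ L) (w : i ≫ p = 0),
      (ShortComplex.mk i p w).ShortExact ∧ Injective I :=
  ⟨_, _, _, _, cokernel.condition (Injective.ι M),
    { exact := ShortComplex.exact_of_g_is_cokernel _ (cokernelIsCokernel (Injective.ι M)) },
    inferInstance⟩

variable [HasExt.{w} C]

theorem subsingleton_ext_of_retract_left {X X' : C} (r : Retract X X') (Y : C) (n : ℕ)
    [Subsingleton (Ext X' Y n)] : Subsingleton (Ext X Y n) := by
  refine subsingleton_of_forall_eq 0 fun x => ?_
  rw [← Ext.mk₀_id_comp x, ← r.retract, ← Ext.mk₀_comp_mk₀_assoc,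
    Subsingleton.elim ((Ext.mk₀ r.r).comp x (zero_add n)) 0, Ext.comp_zero]

theorem subsingleton_ext_of_retract_right {Y Y' : C} (r : Retract Y Y') (X : C) (n : ℕ)
    [Subsingleton (Ext X Y' n)] : Subsingleton (Ext X Y n) := by
  refine subsingleton_of_forall_eq 0 fun x => ?_
  rw [← Ext.comp_mk₀_id x, ← r.retract, ← Ext.mk₀_comp_mk₀,
    ← Ext.comp_assoc_of_second_deg_zero,
    Subsingleton.elim (x.comp (Ext.mk₀ r.i) (add_zero n)) 0, Ext.zero_comp]

variable {S : ShortComplex C}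

theorem CategoryTheory.ShortComplex.ShortExact.subsingleton_ext_X₂_left
    (hS : S.ShortExact) (Y : C) (n : ℕ)
    [Subsingleton (Ext S.X₁ Y n)] [Subsingleton (Ext S.X₃ Y n)] :
    Subsingleton (Ext S.X₂ Y n) := by
  refine subsingleton_of_forall_eq 0 fun x => ?_
  obtain ⟨y, rfl⟩ := Ext.contravariant_sequence_exact₂ hS Y x (Subsingleton.elim _ _)
  rw [Subsingleton.elim y 0, Ext.comp_zero]

theorem CategoryTheory.ShortComplex.ShortExact.subsingleton_ext_X₂_right
    (hS : S.ShortExact) (X : C) (n : ℕ)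
    [Subsingleton (Ext X S.X₁ n)] [Subsingleton (Ext X S.X₃ n)] :
    Subsingleton (Ext X S.X₂ n) := by
  refine subsingleton_of_forall_eq 0 fun x => ?_
  obtain ⟨y, rfl⟩ := Ext.covariant_sequence_exact₂ X hS x (Subsingleton.elim _ _)
  rw [Subsingleton.elim y 0, Ext.zero_comp]

theorem CategoryTheory.ShortComplex.ShortExact.subsingleton_ext_X₁_left
    (hS : S.ShortExact) (Y : C) (n : ℕ)
    [Subsingleton (Ext S.X₂ Y n)] [Subsingleton (Ext S.X₃ Y (n + 1))] :
    Subsingleton (Ext S.X₁ Y n) := by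
  refine subsingleton_of_forall_eq 0 fun x => ?_
  obtain ⟨y, rfl⟩ := Ext.contravariant_sequence_exact₁ hS Y x (add_comm 1 n)
    (Subsingleton.elim _ _)
  rw [Subsingleton.elim y 0, Ext.comp_zero]

theorem CategoryTheory.ShortComplex.ShortExact.subsingleton_ext_X₃_left
    (hS : S.ShortExact) (Y : C) (n : ℕ)
    [Subsingleton (Ext S.X₁ Y n)] [Subsingleton (Ext S.X₂ Y (n + 1))] :
    Subsingleton (Ext S.X₃ Y (n + 1)) := by
  refine subsingleton_of_forall_eq 0 fun x => ?_
  obtain ⟨y, rfl⟩ := Ext.contravariant_sequence_exact₃ hS Y x (Subsingleton.elim _ _)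
    (add_comm 1 n)
  rw [Subsingleton.elim y 0, Ext.comp_zero]

theorem CategoryTheory.ShortComplex.ShortExact.subsingleton_ext_X₁_right
    (hS : S.ShortExact) (X : C) (n : ℕ)
    [Subsingleton (Ext X S.X₃ n)] [Subsingleton (Ext X S.X₂ (n + 1))] :
    Subsingleton (Ext X S.X₁ (n + 1)) := by
  refine subsingleton_of_forall_eq 0 fun x => ?_
  obtain ⟨y, rfl⟩ := Ext.covariant_sequence_exact₁ X hS x (Subsingleton.elim _ _) rfl
  rw [Subsingleton.elim y 0, Ext.zero_comp]

theorem CategoryTheory.ShortComplex.ShortExact.subsingleton_ext_X₃_right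
    (hS : S.ShortExact) (X : C) (n : ℕ)
    [Subsingleton (Ext X S.X₂ n)] [Subsingleton (Ext X S.X₁ (n + 1))] :
    Subsingleton (Ext X S.X₃ n) := by
  refine subsingleton_of_forall_eq 0 fun x => ?_
  obtain ⟨y, rfl⟩ := Ext.covariant_sequence_exact₃ X hS x rfl (Subsingleton.elim _ _)
  rw [Subsingleton.elim y 0, Ext.zero_comp]

/-- If `Ext¹(X₃, Y) = 0` in a short exact sequence, then maps from `X₁` to `Y` extend to `X₂`. -/
theorem CategoryTheory.ShortComplex.ShortExact.exists_extension (hS : S.ShortExact) {Y : C}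
    [Subsingleton (Ext S.X₃ Y 1)] (f : S.X₁ ⟶ Y) : ∃ g : S.X₂ ⟶ Y, S.f ≫ g = f := by
  obtain ⟨x, hx⟩ := Ext.contravariant_sequence_exact₁ hS Y (Ext.mk₀ f) (n₁ := 1) rfl
    (Subsingleton.elim _ _)
  obtain ⟨g, rfl⟩ := (Ext.mk₀_bijective _ _).2 x
  exact ⟨g, (Ext.mk₀_bijective _ _).1 (by rw [← hx, Ext.mk₀_comp_mk₀])⟩

/-- If `Ext¹(X, X₁) = 0` in a short exact sequence, then maps from `X` to `X₃` lift to `X₂`. -/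
theorem CategoryTheory.ShortComplex.ShortExact.exists_lift (hS : S.ShortExact) {X : C}
    [Subsingleton (Ext X S.X₁ 1)] (f : X ⟶ S.X₃) : ∃ g : X ⟶ S.X₂, g ≫ S.g = f := by
  obtain ⟨x, hx⟩ := Ext.covariant_sequence_exact₃ X hS (Ext.mk₀ f) (n₁ := 1) rfl
    (Subsingleton.elim _ _)
  obtain ⟨g, rfl⟩ := (Ext.mk₀_bijective _ _).2 x
  exact ⟨g, (Ext.mk₀_bijective _ _).1 (by rw [← hx, Ext.mk₀_comp_mk₀])⟩

theorem CategoryTheory.ShortComplex.ShortExact.subsingleton_ext_one_of_extension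
    (hS : S.ShortExact) {Y : C}
    [Subsingleton (Ext S.X₂ Y 1)] (h : ∀ f : S.X₁ ⟶ Y, ∃ g : S.X₂ ⟶ Y, S.f ≫ g = f) :
    Subsingleton (Ext S.X₃ Y 1) := by
  refine subsingleton_of_forall_eq 0 fun x => ?_
  obtain ⟨y, rfl⟩ := Ext.contravariant_sequence_exact₃ hS Y x (Subsingleton.elim _ _)
    (n₀ := 0) rfl
  obtain ⟨f, rfl⟩ := (Ext.mk₀_bijective _ _).2 y
  obtain ⟨g, rfl⟩ := h f
  rw [← Ext.mk₀_comp_mk₀, ← Ext.comp_assoc_of_second_deg_zero, hS.extClass_comp, Ext.zero_comp]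

theorem CategoryTheory.ShortComplex.ShortExact.subsingleton_ext_one_of_lift
    (hS : S.ShortExact) {X : C}
    [Subsingleton (Ext X S.X₂ 1)] (h : ∀ f : X ⟶ S.X₃, ∃ g : X ⟶ S.X₂, g ≫ S.g = f) :
    Subsingleton (Ext X S.X₁ 1) := by
  refine subsingleton_of_forall_eq 0 fun x => ?_
  obtain ⟨y, rfl⟩ := Ext.covariant_sequence_exact₁ X hS x (Subsingleton.elim _ _)
    (n₀ := 0) rfl
  obtain ⟨f, rfl⟩ := (Ext.mk₀_bijective _ _).2 y
  obtain ⟨g, rfl⟩ := h f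
  rw [← Ext.mk₀_comp_mk₀, Ext.comp_assoc_of_second_deg_zero, hS.comp_extClass, Ext.comp_zero]

/-- Vanishing of positive-degree `Ext` passes to products in the second variable: shifting dimension
in the first variable reduces to degree one, where a family of extensions of maps is just one. -/
theorem subsingleton_ext_of_isLimit_fan [EnoughProjectives C] {J : Type*} {Y : J → C}
    {c : Fan Y} (hc : IsLimit c) (n : ℕ) (X : C)
    (h : ∀ j, Subsingleton (Ext X (Y j) (n + 1))) : Subsingleton (Ext X c.pt (n + 1)) := by
  induction n generalizing X with
  | zero =>
    obtain ⟨K, P, i, p, w, hS, hP⟩ := exists_shortExact_projective X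
    have := Ext.subsingleton_of_projective P c.pt 0
    refine hS.subsingleton_ext_one_of_extension fun f => ?_
    choose g hg using fun j => (have := h j; hS.exists_extension (f ≫ c.proj j))
    refine ⟨Fan.IsLimit.lift hc g, Fan.IsLimit.hom_ext hc _ _ fun j => ?_⟩
    simpa using hg j
  | succ n ih =>
    obtain ⟨K, P, i, p, w, hS, hP⟩ := exists_shortExact_projective X
    have := Ext.subsingleton_of_projective P c.pt (n + 1)
    have := ih K fun j => by
      have := h j
      have := Ext.subsingleton_of_projective P (Y j) n
      exact hS.subsingleton_ext_X₁_left (Y j) (n + 1)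
    exact hS.subsingleton_ext_X₃_left c.pt (n + 1)

/-- Vanishing of positive-degree `Ext` passes to coproducts in the first variable. Shifting
dimension in the second variable avoids any exactness assumption on coproducts. -/
theorem subsingleton_ext_of_isColimit_cofan [EnoughInjectives C] {J : Type*} {X : J → C}
    {c : Cofan X} (hc : IsColimit c) (n : ℕ) (Y : C)
    (h : ∀ j, Subsingleton (Ext (X j) Y (n + 1))) : Subsingleton (Ext c.pt Y (n + 1)) := by
  induction n generalizing Y with
  | zero =>
    obtain ⟨I, L, i, p, w, hS, hI⟩ := exists_shortExact_injective Y
    have := Ext.subsingleton_of_injective c.pt I 0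
    refine hS.subsingleton_ext_one_of_lift fun f => ?_
    choose g hg using fun j => (have := h j; hS.exists_lift (c.inj j ≫ f))
    refine ⟨Cofan.IsColimit.desc hc g, Cofan.IsColimit.hom_ext hc _ _ fun j => ?_⟩
    simpa [Cofan.IsColimit.fac_assoc] using hg j
  | succ n ih =>
    obtain ⟨I, L, i, p, w, hS, hI⟩ := exists_shortExact_injective Y
    have := Ext.subsingleton_of_injective c.pt I (n + 1)
    have := ih L fun j => by
      have := h j
      have := Ext.subsingleton_of_injective (X j) I n
      exact hS.subsingleton_ext_X₃_right (X j) (n + 1)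
    exact hS.subsingleton_ext_X₁_right c.pt (n + 1)

end Ext

/-! ### Gorenstein projective modules and complete resolutions -/

section GorensteinProjective

open Abelian

variable {R : Type u} [Ring R]

/-- `A` is a first syzygy of `B` (equivalently `B` is a first cosyzygy of `A`): there is a short
exact sequence `0 → A → P → B → 0` with `P` projective. -/
def IsSyzygyOf (A B : ModuleCat.{u} R) : Prop :=
  ∃ (P : ModuleCat.{u} R) (i : A ⟶ P) (p : P ⟶ B) (w : i ≫ p = 0),
    (ShortComplex.mk i p w).ShortExact ∧ Projective P

/-- `Ext` from `M` to every projective module vanishes in all positive degrees. -/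
def IsLeftOrthogonalToProjectives (M : ModuleCat.{u} R) : Prop :=
  ∀ Q : ModuleCat.{u} R, Projective Q → ∀ n : ℕ, Subsingleton (Ext M Q (n + 1))

theorem exists_isSyzygyOf (B : ModuleCat.{u} R) : ∃ A, IsSyzygyOf A B := by
  obtain ⟨K, P, i, p, w, h⟩ := exists_shortExact_projective B
  exact ⟨K, P, i, p, w, h⟩

theorem IsSyzygyOf.isLeftOrthogonalToProjectives {A B : ModuleCat.{u} R} (h : IsSyzygyOf A B)
    (hB : IsLeftOrthogonalToProjectives B) : IsLeftOrthogonalToProjectives A := by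
  obtain ⟨P, i, p, w, hS, hP⟩ := h
  intro Q hQ n
  have := hB Q hQ (n + 1)
  have := Ext.subsingleton_of_projective P Q n
  exact hS.subsingleton_ext_X₁_left Q (n + 1)

theorem IsLeftOrthogonalToProjectives.X₂ {S : ShortComplex (ModuleCat.{u} R)}
    (hS : S.ShortExact) (h₁ : IsLeftOrthogonalToProjectives S.X₁)
    (h₃ : IsLeftOrthogonalToProjectives S.X₃) : IsLeftOrthogonalToProjectives S.X₂ := by
  intro Q hQ n
  have := h₁ Q hQ n
  have := h₃ Q hQ n
  exact hS.subsingleton_ext_X₂_left Q (n + 1)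

/-- Splicing short exact sequences `0 → Z i → P i → Z (i + 1) → 0` yields a complete resolution: its
exactness under `Hom(-, Q)` only needs `Ext¹(Z i, Q) = 0`. The image of `P 0 → P 1` is `Z 1`. -/
theorem isGorensteinProjective_of_isSyzygyOf_seq (Z : ℤ → ModuleCat.{u} R)
    (hZ : ∀ i, IsSyzygyOf (Z i) (Z (i + 1))) (hX : ∀ i, IsLeftOrthogonalToProjectives (Z i)) :
    IsGorensteinProjective (Z 1) := by
  choose P f g w hS hP using hZ
  have hinj i : Function.Injective (f i).hom := (hS i).moduleCat_injective_f
  have hsurj i : Function.Surjective (g i).hom := (hS i).moduleCat_surjective_g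
  have hex i : Function.Exact (f i).hom (g i).hom :=
    (ShortComplex.ShortExact.moduleCat_exact_iff_function_exact _).1 (hS i).exact
  refine ⟨P, fun i => (f (i + 1)).hom ∘ₗ (g i).hom, fun i => inferInstance, fun i => ?_, ?_, ?_⟩
  · intro x
    constructor
    · intro hx
      obtain ⟨z, rfl⟩ := (hex (i + 1) x).1 (hinj _ (by simpa using hx))
      obtain ⟨y, rfl⟩ := hsurj i z
      exact ⟨y, rfl⟩
    · rintro ⟨y, rfl⟩
      have : (g (i + 1)).hom ((f (i + 1)).hom ((g i).hom y)) = 0 :=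
        (hex (i + 1)).apply_apply_eq_zero _
      simp [this]
  · intro Q hQ i φ
    constructor
    · intro hφ
      have hφ' : f (i + 1) ≫ ModuleCat.ofHom φ = 0 := by
        ext z
        obtain ⟨y, rfl⟩ := hsurj i z
        exact LinearMap.congr_fun hφ y
      have := hX (i + 1 + 1 + 1) Q inferInstance 0
      obtain ⟨χ, hχ⟩ := Limits.CokernelCofork.IsColimit.desc' (hS (i + 1)).gIsCokernel _ hφ'
      obtain ⟨ψ, rfl⟩ := (hS (i + 1 + 1)).exists_extension χ
      exact ⟨ψ.hom, congrArg ModuleCat.Hom.hom hχ⟩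
    · rintro ⟨ψ, rfl⟩
      ext y
      have : (g (i + 1)).hom ((f (i + 1)).hom ((g i).hom y)) = 0 :=
        (hex (i + 1)).apply_apply_eq_zero _
      simp [this]
  · refine ⟨(LinearEquiv.ofInjective (f (0 + 1)).hom (hinj _)).trans (LinearEquiv.ofEq _ _ ?_)⟩
    rw [LinearMap.range_comp_of_range_eq_top]
    exact LinearMap.range_eq_top.2 (hsurj 0)

/-- A coinduction principle for Gorenstein projectivity: a class of modules that are left orthogonal
to projectives consists of Gorenstein projective modules as soon as each member is a syzygy of
another member. Ordinary syzygies provide the left half of the complete resolution. -/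
theorem isGorensteinProjective_of_class (𝒞 : ModuleCat.{u} R → Prop)
    (h𝒞 : ∀ M, 𝒞 M → IsLeftOrthogonalToProjectives M)
    (hsyz : ∀ M, 𝒞 M → ∃ Z, IsSyzygyOf M Z ∧ 𝒞 Z) {M : ModuleCat.{u} R} (hM : 𝒞 M) :
    IsGorensteinProjective M := by
  -- Nonnegative indices are iterated cosyzygies inside the class, negative ones iterated syzygies.
  choose co hco hco' using hsyz
  choose sy hsy using exists_isSyzygyOf (R := R)
  let pos : ℕ → {X : ModuleCat.{u} R // 𝒞 X} := fun n =>
    Nat.rec ⟨M, hM⟩ (fun _ X => ⟨co X.1 X.2, hco' X.1 X.2⟩) n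
  let neg : ℕ → ModuleCat.{u} R := fun n => Nat.rec (sy M) (fun _ X => sy X) n
  have hneg n : IsLeftOrthogonalToProjectives (neg n) := by
    induction n with
    | zero => exact (hsy M).isLeftOrthogonalToProjectives (h𝒞 M hM)
    | succ n ih => exact (hsy _).isLeftOrthogonalToProjectives ih
  let Z : ℤ → ModuleCat.{u} R := fun
    | Int.ofNat n => (pos n).1
    | Int.negSucc n => neg n
  have hZ : ∀ i, IsSyzygyOf (Z i) (Z (i + 1)) := fun
    | Int.ofNat n => hco (pos n).1 (pos n).2
    | Int.negSucc 0 => hsy M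
    | Int.negSucc (n + 1) => hsy (neg n)
  have hX : ∀ i, IsLeftOrthogonalToProjectives (Z i) := fun
    | Int.ofNat n => h𝒞 _ (pos n).2
    | Int.negSucc n => hneg n
  -- The splicing lemma sees the module of index `1`, whereas `M` is `Z 0`.
  refine isGorensteinProjective_of_isSyzygyOf_seq (fun i => Z (i - 1)) (fun i => ?_)
    fun i => hX _
  have := hZ (i - 1)
  rwa [show i - 1 + 1 = i + 1 - 1 by ring] at this

theorem IsGorensteinProjective.exists_isSyzygyOf_seq {M : ModuleCat.{u} R}
    (h : IsGorensteinProjective M) :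
    ∃ Z : ℤ → ModuleCat.{u} R, Nonempty (M ≅ Z 0) ∧
      (∀ i, IsSyzygyOf (Z i) (Z (i + 1))) ∧ (∀ i, IsLeftOrthogonalToProjectives (Z i)) := by
  obtain ⟨P, d, hP, hex, hQ, ⟨e⟩⟩ := h
  let Z : ℤ → ModuleCat.{u} R := fun i => ModuleCat.of R (LinearMap.range (d i))
  let f : ∀ i, Z i ⟶ P (i + 1) := fun i => ModuleCat.ofHom (LinearMap.range (d i)).subtype
  let g : ∀ i, P (i + 1) ⟶ Z (i + 1) := fun i => ModuleCat.ofHom (d (i + 1)).rangeRestrict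
  have w i : f i ≫ g i = 0 := by
    ext x
    obtain ⟨_, y, rfl⟩ := x
    exact (hex i).apply_apply_eq_zero y
  have hS i : (ShortComplex.mk (f i) (g i) (w i)).ShortExact := by
    refine ModuleCat.shortComplex_shortExact _ (fun x => ⟨fun hx => ?_, ?_⟩)
      Subtype.val_injective (d (i + 1)).surjective_rangeRestrict
    · obtain ⟨y, rfl⟩ := (hex i x).1 (congrArg Subtype.val hx)
      exact ⟨⟨_, y, rfl⟩, rfl⟩
    · rintro ⟨y, rfl⟩
      exact LinearMap.congr_fun (congrArg ModuleCat.Hom.hom (w i)) y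
  refine ⟨Z, ⟨e.toModuleIso⟩, fun i => ⟨_, f i, g i, w i, hS i, inferInstance⟩, fun i Q hQP n => ?_⟩
  induction n generalizing i with
  | zero =>
    obtain ⟨i, rfl⟩ : ∃ j, i = j + 1 + 1 := ⟨i - 1 - 1, by ring⟩
    have := Ext.subsingleton_of_projective (P (i + 1 + 1)) Q 0
    refine (hS (i + 1)).subsingleton_ext_one_of_extension fun φ => ?_
    obtain ⟨ψ, hψ⟩ := (hQ Q inferInstance i (φ.hom ∘ₗ (d (i + 1)).rangeRestrict)).1 (by
      ext y
      have : (d (i + 1)).rangeRestrict (d i y) = 0 :=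
        Subtype.ext ((hex i).apply_apply_eq_zero y)
      simp [this])
    refine ⟨ModuleCat.ofHom ψ, ?_⟩
    ext x
    obtain ⟨_, y, rfl⟩ := x
    exact LinearMap.congr_fun hψ y
  | succ n ih =>
    obtain ⟨i, rfl⟩ : ∃ j, i = j + 1 := ⟨i - 1, by ring⟩
    have := Ext.subsingleton_of_projective (P (i + 1)) Q (n + 1)
    have := ih i
    exact (hS i).subsingleton_ext_X₃_left Q (n + 1)

theorem IsLeftOrthogonalToProjectives.of_iso {M M' : ModuleCat.{u} R} (e : M ≅ M')
    (h : IsLeftOrthogonalToProjectives M') : IsLeftOrthogonalToProjectives M := fun Q hQ n => by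
  have := h Q hQ n
  exact subsingleton_ext_of_retract_left e.retract Q _

theorem IsSyzygyOf.of_iso {M M' Z : ModuleCat.{u} R} (e : M ≅ M') (h : IsSyzygyOf M' Z) :
    IsSyzygyOf M Z := by
  obtain ⟨P, i, p, w, hS, hP⟩ := h
  refine ⟨P, e.hom ≫ i, p, by simp [w], ShortComplex.shortExact_of_iso ?_ hS, hP⟩
  exact ShortComplex.isoMk e.symm (Iso.refl _) (Iso.refl _)

theorem IsGorensteinProjective.isLeftOrthogonalToProjectives {M : ModuleCat.{u} R}
    (h : IsGorensteinProjective M) : IsLeftOrthogonalToProjectives M := by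
  obtain ⟨Z, ⟨e⟩, -, hX⟩ := h.exists_isSyzygyOf_seq
  exact (hX 0).of_iso e

theorem IsGorensteinProjective.exists_isSyzygyOf {M : ModuleCat.{u} R}
    (h : IsGorensteinProjective M) : ∃ Z, IsSyzygyOf M Z ∧ IsGorensteinProjective Z := by
  obtain ⟨Z, ⟨e⟩, hZ, hX⟩ := h.exists_isSyzygyOf_seq
  exact ⟨Z 1, (hZ 0).of_iso e, isGorensteinProjective_of_isSyzygyOf_seq Z hZ hX⟩

end GorensteinProjective

/-! ### Gorenstein projective resolutions and the Gorenstein global dimension -/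

section Resolutions

open Abelian

variable {R : Type u} [Ring R]

/-- The cokernel of a composite of monomorphisms is an extension of the second cokernel by the
first. -/
theorem exists_shortExact_of_comp {A B D C₁ C₂ : ModuleCat.{u} R} {f : A ⟶ B} {p₁ : B ⟶ C₁}
    {g : B ⟶ D} {p₂ : D ⟶ C₂} {w₁ : f ≫ p₁ = 0} {w₂ : g ≫ p₂ = 0}
    (h₁ : (ShortComplex.mk f p₁ w₁).ShortExact) (h₂ : (ShortComplex.mk g p₂ w₂).ShortExact) :
    ∃ (E : ModuleCat.{u} R) (q : D ⟶ E) (w : (f ≫ g) ≫ q = 0) (a : C₁ ⟶ E) (b : E ⟶ C₂)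
      (w' : a ≫ b = 0), (ShortComplex.mk (f ≫ g) q w).ShortExact ∧
        (ShortComplex.mk a b w').ShortExact := by
  have hmf : Mono f := h₁.mono_f
  have hmg : Mono g := h₂.mono_f
  have hep₁ : Epi p₁ := h₁.epi_g
  have hinj : Function.Injective g.hom := h₂.moduleCat_injective_f
  have hs₁ : Function.Surjective p₁.hom := h₁.moduleCat_surjective_g
  have hs₂ : Function.Surjective p₂.hom := h₂.moduleCat_surjective_g
  have he₁ : Function.Exact f.hom p₁.hom :=
    (ShortComplex.ShortExact.moduleCat_exact_iff_function_exact _).1 h₁.exact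
  have he₂ : Function.Exact g.hom p₂.hom :=
    (ShortComplex.ShortExact.moduleCat_exact_iff_function_exact _).1 h₂.exact
  obtain ⟨E, q, w, hS⟩ : ∃ (E : ModuleCat.{u} R) (q : D ⟶ E) (w : (f ≫ g) ≫ q = 0),
      (ShortComplex.mk (f ≫ g) q w).ShortExact :=
    ⟨_, _, Limits.cokernel.condition _,
      { exact := ShortComplex.exact_of_g_is_cokernel _ (Limits.cokernelIsCokernel _) }⟩
  have hq : Function.Surjective q.hom := hS.moduleCat_surjective_g
  have heq : Function.Exact (f ≫ g).hom q.hom :=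
    (ShortComplex.ShortExact.moduleCat_exact_iff_function_exact _).1 hS.exact
  have : Epi q := hS.epi_g
  obtain ⟨a, ha⟩ := Limits.CokernelCofork.IsColimit.desc' h₁.gIsCokernel (g ≫ q)
    (by simpa using w)
  obtain ⟨b, hb⟩ := Limits.CokernelCofork.IsColimit.desc' hS.gIsCokernel p₂
    (by simp [w₂])
  change p₁ ≫ a = g ≫ q at ha
  change q ≫ b = p₂ at hb
  have w' : a ≫ b = 0 := by
    rw [← cancel_epi p₁, ← Category.assoc, ha, Category.assoc, hb, w₂, Limits.comp_zero]
  have ha' x : a.hom (p₁.hom x) = q.hom (g.hom x) := congrArg (fun φ => φ.hom x) ha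
  have hb' x : b.hom (q.hom x) = p₂.hom x := congrArg (fun φ => φ.hom x) hb
  refine ⟨E, q, w, a, b, w', hS, ModuleCat.shortComplex_shortExact _ (fun x => ⟨fun hx => ?_, ?_⟩)
    ((injective_iff_map_eq_zero a.hom).2 fun x hx => ?_) fun x => ?_⟩
  · obtain ⟨d, rfl⟩ := hq x
    obtain ⟨y, rfl⟩ := (he₂ d).1 ((hb' d).symm.trans hx)
    exact ⟨_, ha' y⟩
  · rintro ⟨y, rfl⟩
    exact congrArg (fun φ => φ.hom y) w'
  · obtain ⟨y, rfl⟩ := hs₁ x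
    rw [ha'] at hx
    obtain ⟨z, hz⟩ := (heq _).1 hx
    obtain rfl := hinj hz
    exact he₁.apply_apply_eq_zero z
  · obtain ⟨y, rfl⟩ := hs₂ x
    exact ⟨_, hb' y⟩

/-- Let `X` be an extension of `B` by `A`, embedded as `A ⊆ Q` and `B ⊆ Q'`. If `A ⊆ Q` extends to a
map `j` from `X`, then `X` embeds in `Q × Q'`, with cokernel an extension of `Q' / B` by `Q / A`. -/
theorem exists_shortExact_prod_of_extension {A X B Q A' Q' B' : ModuleCat.{u} R}
    {f : A ⟶ X} {p : X ⟶ B} {w : f ≫ p = 0} (hX : (ShortComplex.mk f p w).ShortExact)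
    {i : A ⟶ Q} {q : Q ⟶ A'} {wA : i ≫ q = 0} (hA : (ShortComplex.mk i q wA).ShortExact)
    {i' : B ⟶ Q'} {q' : Q' ⟶ B'} {wB : i' ≫ q' = 0} (hB : (ShortComplex.mk i' q' wB).ShortExact)
    {j : X ⟶ Q} (hj : f ≫ j = i) :
    ∃ (Z : ModuleCat.{u} R) (h : X ⟶ ModuleCat.of R (Q × Q')) (r : ModuleCat.of R (Q × Q') ⟶ Z)
      (w₁ : h ≫ r = 0) (a : A' ⟶ Z) (b : Z ⟶ B') (w₂ : a ≫ b = 0),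
      (ShortComplex.mk h r w₁).ShortExact ∧ (ShortComplex.mk a b w₂).ShortExact := by
  have hep : Epi q := hA.epi_g
  have hinj : Function.Injective i.hom := hA.moduleCat_injective_f
  have hinj' : Function.Injective i'.hom := hB.moduleCat_injective_f
  have hs : Function.Surjective q.hom := hA.moduleCat_surjective_g
  have hs' : Function.Surjective q'.hom := hB.moduleCat_surjective_g
  have hsp : Function.Surjective p.hom := hX.moduleCat_surjective_g
  have he : Function.Exact i.hom q.hom :=
    (ShortComplex.ShortExact.moduleCat_exact_iff_function_exact _).1 hA.exact
  have he' : Function.Exact i'.hom q'.hom :=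
    (ShortComplex.ShortExact.moduleCat_exact_iff_function_exact _).1 hB.exact
  have hep : Function.Exact f.hom p.hom :=
    (ShortComplex.ShortExact.moduleCat_exact_iff_function_exact _).1 hX.exact
  have hj' x : j.hom (f.hom x) = i.hom x := congrArg (fun φ => φ.hom x) hj
  let h : X ⟶ ModuleCat.of R (Q × Q') := ModuleCat.ofHom (j.hom.prod (i'.hom ∘ₗ p.hom))
  have hmono : Mono h := by
    refine (ModuleCat.mono_iff_injective _).2 ((injective_iff_map_eq_zero h.hom).2 fun x hx => ?_)
    have h2 : i'.hom (p.hom x) = 0 := congrArg Prod.snd hx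
    obtain ⟨y, rfl⟩ := (hep x).1 (hinj' (h2.trans (map_zero _).symm))
    have h1 : j.hom (f.hom y) = 0 := congrArg Prod.fst hx
    rw [hj'] at h1
    rw [(injective_iff_map_eq_zero i.hom).1 hinj y h1, map_zero]
  obtain ⟨Z, r, w₁, hS⟩ : ∃ (Z : ModuleCat.{u} R) (r : ModuleCat.of R (Q × Q') ⟶ Z)
      (w : h ≫ r = 0), (ShortComplex.mk h r w).ShortExact :=
    ⟨_, _, Limits.cokernel.condition _,
      { exact := ShortComplex.exact_of_g_is_cokernel _ (Limits.cokernelIsCokernel _) }⟩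
  have hr : Function.Surjective r.hom := hS.moduleCat_surjective_g
  have her : Function.Exact h.hom r.hom :=
    (ShortComplex.ShortExact.moduleCat_exact_iff_function_exact _).1 hS.exact
  have hw₁ x : r.hom (j.hom x, i'.hom (p.hom x)) = 0 := congrArg (fun φ => φ.hom x) w₁
  obtain ⟨a, ha⟩ := Limits.CokernelCofork.IsColimit.desc' hA.gIsCokernel
    (ModuleCat.ofHom (LinearMap.inl R Q Q') ≫ r) (by
      ext x
      have := hw₁ (f.hom x)
      rw [hj', hep.apply_apply_eq_zero, map_zero] at this
      exact this)
  obtain ⟨b, hb⟩ := Limits.CokernelCofork.IsColimit.desc' hS.gIsCokernel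
    (ModuleCat.ofHom (LinearMap.snd R Q Q') ≫ q') (by
      ext x
      exact he'.apply_apply_eq_zero (p.hom x))
  have ha' x : a.hom (q.hom x) = r.hom (x, 0) := congrArg (fun φ => φ.hom x) ha
  have hb' (x : Q × Q') : b.hom (r.hom x) = q'.hom x.2 := congrArg (fun φ => φ.hom x) hb
  have hab x : b.hom (a.hom x) = 0 := by
    obtain ⟨y, rfl⟩ := hs x
    rw [ha', hb', map_zero]
  have w₂ : a ≫ b = 0 := by
    ext x
    exact hab x
  refine ⟨Z, h, r, w₁, a, b, w₂, hS, ModuleCat.shortComplex_shortExact _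
    (fun x => ⟨fun hx => ?_, ?_⟩) ((injective_iff_map_eq_zero a.hom).2 fun x hx => ?_) fun x => ?_⟩
  · obtain ⟨⟨y, y'⟩, rfl⟩ := hr x
    obtain ⟨z, rfl⟩ := (he' y').1 ((hb' _).symm.trans hx)
    obtain ⟨z, rfl⟩ := hsp z
    refine ⟨q.hom (y - j.hom z), (ha' _).trans (sub_eq_zero.1 ?_)⟩
    rw [← map_sub, Prod.mk_sub_mk, sub_sub_cancel_left, zero_sub, ← Prod.neg_mk, map_neg, hw₁,
      neg_zero]
  · rintro ⟨y, rfl⟩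
    exact hab y
  · obtain ⟨y, rfl⟩ := hs x
    rw [ha'] at hx
    obtain ⟨z, hz⟩ := (her _).1 hx
    have h2 : i'.hom (p.hom z) = 0 := congrArg Prod.snd hz
    obtain ⟨z, rfl⟩ := (hep z).1 (hinj' (h2.trans (map_zero _).symm))
    have h1 : j.hom (f.hom z) = y := congrArg Prod.fst hz
    rw [← h1, hj', he.apply_apply_eq_zero]
  · obtain ⟨y, rfl⟩ := hs' x
    exact ⟨_, hb' (0, y)⟩

instance projective_of_prod (P Q : ModuleCat.{u} R) [Projective P] [Projective Q] :
    Projective (ModuleCat.of R (P × Q)) :=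
  (IsProjective.iff_projective (P × Q)).1 inferInstance

/-- Gorenstein projective modules are closed under extensions. -/
theorem IsGorensteinProjective.X₂ {S : ShortComplex (ModuleCat.{u} R)} (hS : S.ShortExact)
    (h₁ : IsGorensteinProjective S.X₁) (h₃ : IsGorensteinProjective S.X₃) :
    IsGorensteinProjective S.X₂ := by
  refine isGorensteinProjective_of_class (fun X => ∃ (A B : ModuleCat.{u} R) (f : A ⟶ X)
    (p : X ⟶ B) (w : f ≫ p = 0), (ShortComplex.mk f p w).ShortExact ∧
      IsGorensteinProjective A ∧ IsGorensteinProjective B) ?_ ?_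
      ⟨_, _, S.f, S.g, S.zero, hS, h₁, h₃⟩
  · rintro X ⟨A, B, f, p, w, h, hA, hB⟩
    exact .X₂ h hA.isLeftOrthogonalToProjectives hB.isLeftOrthogonalToProjectives
  · rintro X ⟨A, B, f, p, w, h, hA, hB⟩
    obtain ⟨A', ⟨Q, i, q, wA, hA₁, hQ⟩, hA'⟩ := hA.exists_isSyzygyOf
    obtain ⟨B', ⟨Q', i', q', wB, hB₁, hQ'⟩, hB'⟩ := hB.exists_isSyzygyOf
    have := hB.isLeftOrthogonalToProjectives Q hQ 0
    obtain ⟨j, hj⟩ := h.exists_extension i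
    obtain ⟨Z, m, r, w₁, a, b, w₂, hm, hab⟩ := exists_shortExact_prod_of_extension h hA₁ hB₁ hj
    exact ⟨Z, ⟨_, m, r, w₁, hm, inferInstance⟩, A', B', a, b, w₂, hab, hA', hB'⟩

/-- A module of Gorenstein projective dimension at most `n` embeds in a module of projective
dimension at most `n`, with Gorenstein projective cokernel. -/
theorem HasGorensteinProjectiveResolution.exists_shortExact {n : ℕ} {M : ModuleCat.{u} R}
    (hM : HasGorensteinProjectiveResolution n M) :
    ∃ (H W : ModuleCat.{u} R) (i : M ⟶ H) (p : H ⟶ W) (w : i ≫ p = 0),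
      (ShortComplex.mk i p w).ShortExact ∧ HasProjectiveDimensionLT H (n + 1) ∧
        IsGorensteinProjective W := by
  induction n generalizing M with
  | zero =>
    obtain ⟨W, ⟨H, i, p, w, hS, hH⟩, hW⟩ := IsGorensteinProjective.exists_isSyzygyOf hM
    exact ⟨H, W, i, p, w, hS, inferInstance, hW⟩
  | succ n ih =>
    obtain ⟨K, G, i, p, hi, hex, hp, hG, hK⟩ := hM
    -- With `K ⊆ G ⊆ Q`, the module `M = G / K` embeds in `E = Q / K`, which embeds in `H`, the
    -- cokernel of `H' → Q × Q'`; both cokernels, hence that of `M → H`, are Gorenstein projective.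
    have w : ModuleCat.ofHom i ≫ ModuleCat.ofHom p = 0 :=
      ModuleCat.hom_ext hex.linearMap_comp_eq_zero
    have hKGM : (ShortComplex.mk (ModuleCat.ofHom i) (ModuleCat.ofHom p) w).ShortExact :=
      ModuleCat.shortComplex_shortExact _ hex hi hp
    obtain ⟨H', B, f, r, w', hH', hpd, hB⟩ := ih hK
    obtain ⟨G₁, ⟨Q, k, q, wQ, hQ, hPQ⟩, hG₁⟩ := hG.exists_isSyzygyOf
    obtain ⟨B', ⟨Q', k', q', wQ', hQ', hPQ'⟩, hB'⟩ := hB.exists_isSyzygyOf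
    obtain ⟨E, s, ws, a, b, wab, hs, hab⟩ := exists_shortExact_of_comp hKGM hQ
    have := hB.isLeftOrthogonalToProjectives Q hPQ 0
    obtain ⟨j, hj⟩ := hH'.exists_extension (ModuleCat.ofHom i ≫ k)
    obtain ⟨H, m, t, w₁, c, d, w₂, hm, hcd⟩ := exists_shortExact_prod_of_extension hH' hs hQ' hj
    obtain ⟨W, v, wv, x, y, wxy, hv, hxy⟩ := exists_shortExact_of_comp hab hcd
    exact ⟨H, W, a ≫ c, v, wv, hv, hm.hasProjectiveDimensionLT_X₃ (n + 1) hpd inferInstance,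
      .X₂ hxy hG₁ hB'⟩

theorem HasGorensteinProjectiveResolution.subsingleton_ext {n : ℕ} {M : ModuleCat.{u} R}
    (hM : HasGorensteinProjectiveResolution n M) (Q : ModuleCat.{u} R) [Projective Q] (i : ℕ) :
    Subsingleton (Ext M Q (n + 1 + i)) := by
  obtain ⟨H, W, f, p, w, hS, hH, hW⟩ := hM.exists_shortExact
  have := HasProjectiveDimensionLT.subsingleton H (n + 1) (n + 1 + i) (by lia) Q
  have := hW.isLeftOrthogonalToProjectives Q inferInstance (n + 1 + i)
  exact hS.subsingleton_ext_X₁_left Q (n + 1 + i)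

/-- A module of finite projective dimension without higher extensions by projectives is projective:
dimension shifting in the second variable lowers the degree from which `Ext` vanishes. -/
theorem projective_of_isLeftOrthogonalToProjectives {H : ModuleCat.{u} R} {n : ℕ}
    [HasProjectiveDimensionLT H n] (h : IsLeftOrthogonalToProjectives H) : Projective H := by
  suffices ∀ (k m : ℕ), n ≤ m + k → ∀ Y, Subsingleton (Ext H Y (m + 1)) from
    projective_iff_subsingleton_ext_one.2 (this n 0 (by lia))
  intro k
  induction k with
  | zero => exact fun m hm Y => HasProjectiveDimensionLT.subsingleton H n (m + 1) (by lia) Y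
  | succ k ih =>
    intro m hm Y
    obtain ⟨K, P, i, p, w, hS, hP⟩ := exists_shortExact_projective Y
    have := ih (m + 1) (by lia) K
    have := h P hP m
    exact hS.subsingleton_ext_X₃_right H (m + 1)

/-- If all modules have finite Gorenstein projective dimension, left orthogonality to projectives
already characterizes the Gorenstein projective modules. -/
theorem IsLeftOrthogonalToProjectives.isGorensteinProjective
    (hfin : ∀ M : ModuleCat.{u} R, ∃ n, HasGorensteinProjectiveResolution n M)
    {M : ModuleCat.{u} R} (hM : IsLeftOrthogonalToProjectives M) : IsGorensteinProjective M := by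
  refine isGorensteinProjective_of_class IsLeftOrthogonalToProjectives (fun _ h => h)
    (fun X hX => ?_) hM
  obtain ⟨n, hn⟩ := hfin X
  obtain ⟨H, W, i, p, w, hS, hH, hW⟩ := hn.exists_shortExact
  have := projective_of_isLeftOrthogonalToProjectives (n := n + 1)
    (IsLeftOrthogonalToProjectives.X₂ hS hX hW.isLeftOrthogonalToProjectives)
  exact ⟨W, ⟨H, i, p, w, hS, this⟩, hW.isLeftOrthogonalToProjectives⟩

theorem hasGorensteinProjectiveResolution_of_subsingleton_ext
    (hfin : ∀ M : ModuleCat.{u} R, ∃ n, HasGorensteinProjectiveResolution n M)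
    {n : ℕ} {M : ModuleCat.{u} R}
    (hM : ∀ Q : ModuleCat.{u} R, Projective Q → ∀ i, Subsingleton (Ext M Q (n + 1 + i))) :
    HasGorensteinProjectiveResolution n M := by
  induction n generalizing M with
  | zero =>
    refine IsLeftOrthogonalToProjectives.isGorensteinProjective hfin fun Q hQ i => ?_
    have := hM Q hQ i
    rwa [show 0 + 1 + i = i + 1 by lia] at this
  | succ n ih =>
    obtain ⟨K, P, i, p, w, hS, hP⟩ := exists_shortExact_projective M
    refine ⟨K, P, i.hom, p.hom, hS.moduleCat_injective_f,
      (ShortComplex.ShortExact.moduleCat_exact_iff_function_exact _).1 hS.exact,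
      hS.moduleCat_surjective_g, IsLeftOrthogonalToProjectives.isGorensteinProjective hfin
        fun Q _ n => Ext.subsingleton_of_projective P Q n, ih fun Q hQ k => ?_⟩
    have := hM Q hQ k
    have := Ext.subsingleton_of_projective P Q (n + k)
    rw [show n + k + 1 = n + 1 + k by lia] at this
    rw [show n + 1 + 1 + k = n + 1 + k + 1 by lia] at *
    exact hS.subsingleton_ext_X₁_left Q (n + 1 + k)

theorem gorensteinProjectiveDim_le_iff_exists (M : ModuleCat.{u} R) (n : ℕ) :
    gorensteinProjectiveDim M ≤ n ↔ ∃ m ≤ n, HasGorensteinProjectiveResolution m M := by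
  refine ⟨fun h => ?_, fun ⟨m, hm, h⟩ => (iInf₂_le m h).trans (by exact_mod_cast hm)⟩
  by_contra! hc
  have : ((n + 1 : ℕ) : ℕ∞) ≤ gorensteinProjectiveDim M := le_iInf₂ fun m hm => by
    by_contra hlt
    exact hc m (by have : m < n + 1 := by exact_mod_cast not_le.1 hlt
                   lia) hm
  have := this.trans h
  norm_cast at this
  lia

theorem leftGorensteinGlobalDim_lt_iff_exists {n : ℕ} (hn : 0 < n) :
    leftGorensteinGlobalDim R < n ↔
      ∀ M : ModuleCat.{u} R, ∃ m < n, HasGorensteinProjectiveResolution m M := by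
  obtain ⟨n, rfl⟩ := Nat.exists_eq_succ_of_ne_zero hn.ne'
  have : leftGorensteinGlobalDim R < (n.succ : ℕ) ↔ leftGorensteinGlobalDim R ≤ n := by
    rw [Nat.succ_eq_add_one, Nat.cast_add, Nat.cast_one,
      ENat.lt_add_one_iff (ENat.natCast_ne_top n)]
  rw [this]
  simp only [leftGorensteinGlobalDim, iSup_le_iff, gorensteinProjectiveDim_le_iff_exists,
    Nat.lt_succ_iff]

theorem exists_hasGorensteinProjectiveResolution (hfin : leftGorensteinGlobalDim R < ⊤) :
    ∃ d, ∀ M : ModuleCat.{u} R, ∃ m < d, HasGorensteinProjectiveResolution m M := by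
  obtain ⟨d, hd⟩ := ENat.ne_top_iff_exists.1 hfin.ne
  refine ⟨d + 1, (leftGorensteinGlobalDim_lt_iff_exists d.succ_pos).1 ?_⟩
  rw [← hd]
  exact_mod_cast d.lt_succ_self

/-- When finite, the Gorenstein global dimension is less than `n` iff every projective module has
injective dimension less than `n`. -/
theorem leftGorensteinGlobalDim_lt_iff_forall_projective (hfin : leftGorensteinGlobalDim R < ⊤)
    {n : ℕ} (hn : 0 < n) :
    leftGorensteinGlobalDim R < n ↔
      ∀ P : ModuleCat.{u} R, Projective P → ∀ M : ModuleCat.{u} R, Subsingleton (Ext M P n) := by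
  rw [leftGorensteinGlobalDim_lt_iff_exists hn]
  constructor
  · intro h P hP M
    obtain ⟨m, hm, hM⟩ := h M
    obtain ⟨i, rfl⟩ := Nat.exists_eq_add_of_le (Nat.succ_le_of_lt hm)
    exact hM.subsingleton_ext P i
  · intro h M
    obtain ⟨n, rfl⟩ := Nat.exists_eq_succ_of_ne_zero hn.ne'
    obtain ⟨d, hd⟩ := exists_hasGorensteinProjectiveResolution hfin
    refine ⟨n, n.lt_succ_self, hasGorensteinProjectiveResolution_of_subsingleton_ext
      (fun M => (hd M).imp fun _ h => h.2) fun Q hQ i => ?_⟩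
    have := hasInjectiveDimensionLT_of_enoughProjectives Q (n + 1) (h Q hQ)
    exact HasInjectiveDimensionLT.subsingleton Q (n + 1) (n + 1 + i) (by lia) M

/-- When finite, the Gorenstein global dimension is less than `n` iff every injective module has
projective dimension less than `n`. -/
theorem leftGorensteinGlobalDim_lt_iff_forall_injective (hfin : leftGorensteinGlobalDim R < ⊤)
    {n : ℕ} (hn : 0 < n) :
    leftGorensteinGlobalDim R < n ↔
      ∀ I : ModuleCat.{u} R, Injective I → ∀ M : ModuleCat.{u} R, Subsingleton (Ext I M n) := by
  constructor
  · intro h I hI M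
    obtain ⟨m, hm, hres⟩ := (leftGorensteinGlobalDim_lt_iff_exists hn).1 h I
    obtain ⟨H, W, i, p, w, hS, hH, hW⟩ := hres.exists_shortExact
    -- As `I` is injective, its embedding in a module of finite projective dimension splits.
    have hmono : Mono i := hS.mono_f
    have := HasProjectiveDimensionLT.subsingleton H (m + 1) n hm M
    exact subsingleton_ext_of_retract_left
      ⟨i, Injective.factorThru (𝟙 I) i, Injective.comp_factorThru _ _⟩ M n
  · intro h
    rw [leftGorensteinGlobalDim_lt_iff_forall_projective hfin hn]
    obtain ⟨d, hd⟩ := exists_hasGorensteinProjectiveResolution hfin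
    intro P hP
    -- Descending induction on the degree: `Ext^i(M, P)` vanishes for `i ≥ d`, and for `i ≥ n` it
    -- embeds in `Ext^(i + 1)(L, P)` for any cosyzygy `L` of `M` in an injective module.
    suffices ∀ k i, n ≤ i → d ≤ i + k → ∀ M : ModuleCat.{u} R, Subsingleton (Ext M P i) from
      this d n le_rfl (by lia)
    intro k
    induction k with
    | zero =>
      intro i hi hdi M
      obtain ⟨m, hm, hM⟩ := hd M
      obtain ⟨j, rfl⟩ := Nat.exists_eq_add_of_le (show m + 1 ≤ i by lia)
      exact hM.subsingleton_ext P j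
    | succ k ih =>
      intro i hi hdi M
      obtain ⟨I, L, f, p, w, hS, hI⟩ := exists_shortExact_injective M
      have := ih (i + 1) (by lia) (by lia) L
      have := hasProjectiveDimensionLT_of_enoughInjectives I n (h I hI)
      have := HasProjectiveDimensionLT.subsingleton I n i hi P
      exact hS.subsingleton_ext_X₁_left P i

end Resolutions

/-! ### Modules over semiprimary rings -/

section Semiprimary

open Abelian

variable {R : Type u} [Ring R] {N : Ideal R}

theorem Module.IsTorsionBySet.isSemisimpleModule [N.IsTwoSided] [IsSemisimpleRing (R ⧸ N)]
    {M : Type*} [AddCommGroup M] [Module R M] (hM : Module.IsTorsionBySet R M N) :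
    IsSemisimpleModule R M := by
  let _ := hM.module
  have : RingHomSurjective (Ideal.Quotient.mk N) := ⟨Ideal.Quotient.mk_surjective⟩
  exact (LinearMap.isSemisimpleModule_iff_of_bijective hM.semilinearMap
    Function.bijective_id).2 inferInstance

theorem isTorsionBySet_quotient (N : Ideal R) [N.IsTwoSided] :
    Module.IsTorsionBySet R (R ⧸ N) N := by
  intro x a
  obtain ⟨r, rfl⟩ := Ideal.Quotient.mk_surjective x
  exact Ideal.Quotient.eq_zero_iff_mem.2 (N.mul_mem_right r a.2)

theorem isNilpotent_of_mem {a : R} (hN : IsNilpotent N) (ha : a ∈ N) : IsNilpotent a := by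
  obtain ⟨k, hk⟩ := hN
  refine ⟨k, ?_⟩
  have := Ideal.pow_mem_pow ha k
  rwa [hk] at this

/-- If `a • x ≠ 0` in a simple module, then `x = r • a • x` for some `r`, which is impossible when
`r * a` is nilpotent. -/
theorem IsSimpleModule.smul_eq_zero_of_isNilpotent {S : Type*} [Ring S] {M : Type*}
    [AddCommGroup M] [Module S M] [IsSimpleModule S M] {a : S}
    (ha : ∀ r : S, IsNilpotent (r * a)) (x : M) : a • x = 0 := by
  by_contra hx
  obtain ⟨r, hr⟩ := IsSimpleModule.toSpanSingleton_surjective S hx x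
  have hfix : (r * a) • x = x := by simpa [mul_smul] using hr
  obtain ⟨k, hk⟩ := ha r
  have hpow j : (r * a) ^ j • x = x := by
    induction j with
    | zero => simp
    | succ j ih => rw [pow_succ, mul_smul, hfix, ih]
  have h0 : x = 0 := by rw [← hpow k, hk, zero_smul]
  exact hx (by simp [h0])

theorem IsSimpleModule.isTorsionBySet (hN : IsNilpotent N) (M : Type*)
    [AddCommGroup M] [Module R M] [IsSimpleModule R M] : Module.IsTorsionBySet R M N :=
  fun x a => smul_eq_zero_of_isNilpotent
    (fun r => isNilpotent_of_mem hN (N.mul_mem_left r a.2)) x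

theorem IsSimpleModule.exists_retract_quotient [N.IsTwoSided] [IsSemisimpleRing (R ⧸ N)]
    (hN : IsNilpotent N) (M : ModuleCat.{u} R) [IsSimpleModule R M] :
    Nonempty (Retract M (ModuleCat.of R (R ⧸ N))) := by
  have := IsSimpleModule.nontrivial R M
  obtain ⟨x, hx⟩ := exists_ne (0 : M)
  let f : (R ⧸ N) →ₗ[R] M := Submodule.liftQ N (LinearMap.toSpanSingleton R M x)
    fun a ha => IsSimpleModule.isTorsionBySet hN M (x := x) (a := ⟨a, ha⟩)
  have hf : Function.Surjective f := by
    intro y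
    obtain ⟨r, rfl⟩ := IsSimpleModule.toSpanSingleton_surjective R hx y
    exact ⟨Ideal.Quotient.mk N r, rfl⟩
  have := (isTorsionBySet_quotient N).isSemisimpleModule
  obtain ⟨g, hg⟩ := IsSemisimpleModule.lifting_property f hf LinearMap.id
  exact ⟨⟨ModuleCat.ofHom g, ModuleCat.ofHom f, ModuleCat.hom_ext hg⟩⟩

/-- A property of modules that is closed under extensions and holds for modules killed by the
nilpotent ideal `N` holds for all modules, because of the finite filtration `M ⊇ N M ⊇ N² M ⊇ ⋯`. -/
theorem of_isTorsionBySet_of_isNilpotent [N.IsTwoSided] (hN : IsNilpotent N)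
    {Φ : ModuleCat.{u} R → Prop}
    (hΦ : ∀ M : ModuleCat.{u} R, Module.IsTorsionBySet R M N → Φ M)
    (hext : ∀ S : ShortComplex (ModuleCat.{u} R), S.ShortExact → Φ S.X₁ → Φ S.X₃ → Φ S.X₂)
    (M : ModuleCat.{u} R) : Φ M := by
  obtain ⟨k, hk⟩ := hN
  have hM : ∀ a ∈ N ^ k, ∀ x : M, a • x = 0 := by
    rw [hk]
    rintro a rfl x
    exact zero_smul R x
  clear hk
  induction k generalizing M with
  | zero =>
    have (x : M) : x = 0 := by
      simpa using hM 1 (by rw [Submodule.pow_zero, Ideal.one_eq_top]; exact Submodule.mem_top) x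
    exact hΦ M fun x _ => this _
  | succ k ih =>
    let L : Submodule R M := N • ⊤
    have hS : (ShortComplex.mk (ModuleCat.ofHom L.subtype) (ModuleCat.ofHom L.mkQ)
        (by ext x; simp)).ShortExact :=
      ModuleCat.shortComplex_shortExact _ (LinearMap.exact_subtype_mkQ L) L.injective_subtype
        L.mkQ_surjective
    refine hext _ hS (ih _ fun a ha x => ?_) (hΦ _ fun x a => ?_)
    · obtain ⟨x, hx⟩ := x
      refine Subtype.ext ?_
      change a • x = 0
      induction hx using Submodule.smul_induction_on' with
      | smul b hb y _ =>
        rw [smul_smul]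
        exact hM _ (by rw [Submodule.pow_succ]; exact Ideal.mul_mem_mul ha hb) y
      | add x _ y _ hx hy => rw [smul_add, hx, hy, add_zero]
    · obtain ⟨y, rfl⟩ := L.mkQ_surjective x
      exact (Submodule.Quotient.mk_eq_zero L).2
        (Submodule.smul_mem_smul a.2 (Submodule.mem_top (x := y)))

/-- If a semisimple module `M` is the sum of submodules `L` with `Ext(L, Y) = 0`, then
`Ext(M, Y) = 0`, as `M` is a retract of their direct sum. -/
theorem subsingleton_ext_of_sSup_eq_top {M : ModuleCat.{u} R} [IsSemisimpleModule R M]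
    (Y : ModuleCat.{u} R) (n : ℕ)
    (h : sSup {L : Submodule R M | Subsingleton (Ext (ModuleCat.of R L) Y (n + 1))} = ⊤) :
    Subsingleton (Ext M Y (n + 1)) := by
  classical
  set s := {L : Submodule R M | Subsingleton (Ext (ModuleCat.of R L) Y (n + 1))}
  let X : s → ModuleCat.{u} R := fun L => ModuleCat.of R L.1
  have hD : Subsingleton (Ext (ModuleCat.of R (DirectSum s fun L => X L)) Y (n + 1)) :=
    subsingleton_ext_of_isColimit_cofan (ModuleCat.coproductCoconeIsColimit X) n Y fun L => L.2
  let f : (Π₀ L : s, X L) →ₗ[R] M := DFinsupp.lsum ℕ fun L : s => L.1.subtype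
  have hf : Function.Surjective f := by
    rw [← LinearMap.range_eq_top, ← h, sSup_eq_iSup', Submodule.iSup_eq_range_dfinsupp_lsum]
  obtain ⟨g, hg⟩ := IsSemisimpleModule.lifting_property f hf LinearMap.id
  exact subsingleton_ext_of_retract_left (X' := ModuleCat.of R (DirectSum s fun L => X L))
    ⟨ModuleCat.ofHom g, ModuleCat.ofHom f, ModuleCat.hom_ext hg⟩ Y (n + 1)

/-- If maps to modules `E` killed by `N` with `Ext(X, E) = 0` separate the points of `M`, then
`Ext(X, M) = 0`: `M` embeds in a product of such modules, which is again killed by `N`, hence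
semisimple, so that the embedding splits. -/
theorem subsingleton_ext_of_separating [N.IsTwoSided] [IsSemisimpleRing (R ⧸ N)]
    {M : ModuleCat.{u} R} (X : ModuleCat.{u} R) (n : ℕ)
    (h : ∀ x : M, x ≠ 0 → ∃ E : ModuleCat.{u} R, Module.IsTorsionBySet R E N ∧
      Subsingleton (Ext X E (n + 1)) ∧ ∃ f : M →ₗ[R] E, f x ≠ 0) :
    Subsingleton (Ext X M (n + 1)) := by
  choose E hE hX f hf using h
  let Y : {x : M // x ≠ 0} → ModuleCat.{u} R := fun x => E x.1 x.2
  have hP : Subsingleton (Ext X (ModuleCat.of R (∀ x, Y x)) (n + 1)) :=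
    subsingleton_ext_of_isLimit_fan (ModuleCat.productConeIsLimit Y) n X fun x => hX x.1 x.2
  have : IsSemisimpleModule R (∀ x, Y x) :=
    Module.IsTorsionBySet.isSemisimpleModule (N := N) fun y a =>
      funext fun x => @hE x.1 x.2 (y x) a
  let g : M →ₗ[R] (∀ x, Y x) := LinearMap.pi fun x => f x.1 x.2
  have hg : Function.Injective g := by
    refine (injective_iff_map_eq_zero g).2 fun x hx => ?_
    by_contra h0
    exact hf x h0 (congrFun hx ⟨x, h0⟩)
  obtain ⟨r, hr⟩ := IsSemisimpleModule.extension_property g hg LinearMap.id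
  exact subsingleton_ext_of_retract_right (Y' := ModuleCat.of R (∀ x, Y x))
    ⟨ModuleCat.ofHom g, ModuleCat.ofHom r, ModuleCat.hom_ext hr⟩ X (n + 1)

theorem IsSemisimpleModule.exists_isSimpleModule_apply_ne_zero {M : Type*} [AddCommGroup M]
    [Module R M] [IsSemisimpleModule R M] {x : M} (hx : x ≠ 0) :
    ∃ (L : Submodule R M) (_ : IsSimpleModule R L) (f : M →ₗ[R] L), f x ≠ 0 := by
  obtain h | ⟨L, hL, hs⟩ := IsSemisimpleModule.eq_bot_or_exists_simple_le (Submodule.span R {x})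
  · exact absurd (Submodule.span_singleton_eq_bot.1 h) hx
  obtain ⟨f, hf⟩ := IsSemisimpleModule.extension_property L.subtype L.injective_subtype LinearMap.id
  refine ⟨L, hs, f, fun h0 => ?_⟩
  have := IsSimpleModule.nontrivial R L
  obtain ⟨y, hy⟩ := exists_ne (0 : L)
  obtain ⟨r, hr⟩ := Submodule.mem_span_singleton.1 (hL y.2)
  refine hy ?_
  have h1 : f y = y := LinearMap.congr_fun hf y
  rw [← h1, ← hr, map_smul, h0, smul_zero]

end Semiprimary

/-! ### Character duals and Ext-Tor duality -/

section CharacterDual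

open Abelian TensorProduct

variable {R : Type u} [Ring R]

/-- The character dual `Hom_ℤ(C, ℚ/ℤ)` of a right module `C`, as a left module:
`(r • f) c = f (c r)`. -/
noncomputable def characterDual (C : ModuleCat.{u} Rᵐᵒᵖ) : ModuleCat.{u} R :=
  letI : Module R (C →+ AddCircle (1 : ℚ)) :=
    { smul := fun r f => f.comp (DistribSMul.toAddMonoidHom C (MulOpposite.op r))
      one_smul := fun f => AddMonoidHom.ext fun c => congrArg f (one_smul _ c)
      mul_smul := fun r s f => AddMonoidHom.ext fun c =>
        congrArg f (mul_smul (MulOpposite.op s) (MulOpposite.op r) c)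
      smul_zero := fun _ => rfl
      smul_add := fun _ _ _ => rfl
      add_smul := fun r s f => AddMonoidHom.ext fun c =>
        (congrArg f (add_smul (MulOpposite.op r) (MulOpposite.op s) c)).trans (map_add f _ _)
      zero_smul := fun f => AddMonoidHom.ext fun c =>
        (congrArg f (zero_smul _ c)).trans (map_zero f) }
  ModuleCat.of R (C →+ AddCircle (1 : ℚ))

/-- The elements of the character dual, viewed as additive maps. -/
noncomputable def characterDual.toAddMonoidHom {C : ModuleCat.{u} Rᵐᵒᵖ} :
    characterDual C ≃+ (C →+ AddCircle (1 : ℚ)) :=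
  AddEquiv.refl _

theorem characterDual.smul_apply {C : ModuleCat.{u} Rᵐᵒᵖ} (r : R) (f : characterDual C) (c : C) :
    toAddMonoidHom (r • f) c = toAddMonoidHom f (MulOpposite.op r • c) :=
  rfl

/-- The tensor-hom adjunction `Hom_ℤ(C ⊗_R M, ℚ/ℤ) → Hom_R(M, Hom_ℤ(C, ℚ/ℤ))`; it is bijective and
natural in `M`. -/
noncomputable def characterDual.curry {C : ModuleCat.{u} Rᵐᵒᵖ} {M : ModuleCat.{u} R}
    (χ : BalancedTensor C M →+ AddCircle (1 : ℚ)) : M →ₗ[R] characterDual C where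
  toFun m := toAddMonoidHom.symm
    { toFun := fun c => χ (QuotientAddGroup.mk (c ⊗ₜ[ℤ] m))
      map_zero' := by rw [zero_tmul, QuotientAddGroup.mk_zero, map_zero]
      map_add' := fun c c' => by rw [add_tmul, QuotientAddGroup.mk_add, map_add] }
  map_add' m m' := by
    refine toAddMonoidHom.injective (AddMonoidHom.ext fun c => ?_)
    change χ (QuotientAddGroup.mk (c ⊗ₜ[ℤ] (m + m'))) = χ (QuotientAddGroup.mk (c ⊗ₜ[ℤ] m)) +
      χ (QuotientAddGroup.mk (c ⊗ₜ[ℤ] m'))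
    rw [tmul_add, QuotientAddGroup.mk_add, map_add]
  map_smul' r m := by
    refine toAddMonoidHom.injective (AddMonoidHom.ext fun c => ?_)
    change χ (QuotientAddGroup.mk (c ⊗ₜ[ℤ] (r • m))) =
      χ (QuotientAddGroup.mk ((MulOpposite.op r • c) ⊗ₜ[ℤ] m))
    refine congrArg χ ((QuotientAddGroup.eq_iff_sub_mem).2 ?_)
    rw [← neg_sub]
    exact neg_mem (AddSubgroup.subset_closure ⟨c, r, m, rfl⟩)

theorem characterDual.curry_apply {C : ModuleCat.{u} Rᵐᵒᵖ} {M : ModuleCat.{u} R}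
    (χ : BalancedTensor C M →+ AddCircle (1 : ℚ)) (m : M) (c : C) :
    toAddMonoidHom (curry χ m) c = χ (QuotientAddGroup.mk (c ⊗ₜ[ℤ] m)) :=
  rfl

theorem characterDual.curry_injective {C : ModuleCat.{u} Rᵐᵒᵖ} {M : ModuleCat.{u} R} :
    Function.Injective (curry (C := C) (M := M)) := fun χ χ' h =>
  balancedTensor_hom_ext fun c m => by
    rw [← curry_apply, ← curry_apply, h]

theorem characterDual.curry_surjective {C : ModuleCat.{u} Rᵐᵒᵖ} {M : ModuleCat.{u} R} :
    Function.Surjective (curry (C := C) (M := M)) := by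
  intro f
  let F : C →+ M →+ AddCircle (1 : ℚ) :=
    AddMonoidHom.flip (toAddMonoidHom.toAddMonoidHom.comp f.toAddMonoidHom)
  let χ : C ⊗[ℤ] M →+ AddCircle (1 : ℚ) := TensorProduct.liftAddHom F fun z c m => by
    rw [map_zsmul, map_zsmul, AddMonoidHom.zsmul_apply]
  refine ⟨QuotientAddGroup.lift (balancedRelations C M) χ ?_, ?_⟩
  · refine (AddSubgroup.closure_le _).2 ?_
    rintro x ⟨c, r, m, rfl⟩
    change χ _ = 0
    rw [map_sub, sub_eq_zero]
    exact (DFunLike.congr_fun (congrArg toAddMonoidHom (f.map_smul r m)) c).symm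
  · ext m
    exact toAddMonoidHom.injective (AddMonoidHom.ext fun c => rfl)

theorem characterDual.curry_comp {C : ModuleCat.{u} Rᵐᵒᵖ} {M M' : ModuleCat.{u} R}
    (χ : BalancedTensor C M' →+ AddCircle (1 : ℚ)) (f : M ⟶ M') :
    curry (χ.comp (balancedTensorMap C f)) = curry χ ∘ₗ f.hom :=
  rfl

/-- A pair of maps of abelian groups is exact iff its character dual is, since `ℚ/ℤ` is an injective
cogenerator. The inclusion of the image of `f` in the kernel of `g` plays no role here. -/
theorem AddMonoidHom.exact_iff_forall_character {A B D : Type*} [AddCommGroup A] [AddCommGroup B]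
    [AddCommGroup D] (f : A →+ B) (g : B →+ D) :
    (∀ b, g b = 0 → ∃ a, f a = b) ↔ ∀ χ : B →+ AddCircle (1 : ℚ), χ.comp f = 0 →
      ∃ ψ : D →+ AddCircle (1 : ℚ), ψ.comp g = χ := by
  constructor
  · intro h χ hχ
    have hker : g.ker ≤ χ.ker := fun b hb => by
      obtain ⟨a, rfl⟩ := h b hb
      exact DFunLike.congr_fun hχ a
    let χ' : g.range →+ AddCircle (1 : ℚ) := (QuotientAddGroup.lift g.ker χ hker).comp
      (QuotientAddGroup.quotientKerEquivRange g).symm.toAddMonoidHom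
    have hχ' b : χ' ⟨g b, b, rfl⟩ = χ b := by
      have : (QuotientAddGroup.quotientKerEquivRange g).symm ⟨g b, b, rfl⟩ =
          QuotientAddGroup.mk b := by
        rw [AddEquiv.symm_apply_eq]
        rfl
      change QuotientAddGroup.lift g.ker χ hker
        ((QuotientAddGroup.quotientKerEquivRange g).symm ⟨g b, b, rfl⟩) = _
      rw [this, QuotientAddGroup.lift_mk]
    obtain ⟨ψ, hψ⟩ := CharacterModule.dual_surjective_of_injective
      g.range.subtype.toIntLinearMap Subtype.val_injective χ'
    refine ⟨ψ, AddMonoidHom.ext fun b => ?_⟩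
    rw [← hχ' b, ← hψ]
    rfl
  · intro h b hb
    by_contra hne
    have hb' : (QuotientAddGroup.mk b : B ⧸ f.range) ≠ 0 := fun h0 =>
      hne ((QuotientAddGroup.eq_zero_iff b).1 h0)
    obtain ⟨χ, hχ⟩ := CharacterModule.exists_character_apply_ne_zero_of_ne_zero hb'
    obtain ⟨ψ, hψ⟩ := h (AddMonoidHom.comp χ (QuotientAddGroup.mk' f.range))
      (AddMonoidHom.ext fun a => by
        have : (QuotientAddGroup.mk (f a) : B ⧸ f.range) = 0 :=
          (QuotientAddGroup.eq_zero_iff _).2 ⟨a, rfl⟩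
        exact (congrArg χ this).trans (map_zero χ))
    refine hχ ((DFunLike.congr_fun hψ b).symm.trans ?_)
    rw [AddMonoidHom.comp_apply, hb, map_zero]

/-- `Ext` of positive degree as the cohomology of `Hom(P, Y)` for a projective resolution `P`. -/
theorem ext_succ_subsingleton_iff {C : Type*} [Category C] [Abelian C] [HasExt C] {X : C}
    (P : ProjectiveResolution X) (Y : C) (n : ℕ) :
    Subsingleton (Ext X Y (n + 1)) ↔ ∀ f : P.complex.X (n + 1) ⟶ Y,
      P.complex.d (n + 2) (n + 1) ≫ f = 0 → ∃ g, P.complex.d (n + 1) n ≫ g = f := by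
  constructor
  · intro h f hf
    exact (P.extMk_eq_zero_iff f (n + 2) rfl hf n rfl).1 (Subsingleton.elim _ _)
  · refine fun h => subsingleton_of_forall_eq 0 fun x => ?_
    obtain ⟨f, hf, rfl⟩ := P.extMk_surjective x (n + 2) rfl
    exact (P.extMk_eq_zero_iff f (n + 2) rfl hf n rfl).2 (h f hf)

/-- `Tor` of positive degree as the homology of `C ⊗_R P` for a projective resolution `P`. -/
theorem subsingleton_torGroup_succ_iff {M : ModuleCat.{u} R} (P : ProjectiveResolution M)
    (C : ModuleCat.{u} Rᵐᵒᵖ) (n : ℕ) :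
    Subsingleton (torGroup (n + 1) C M) ↔
      ∀ x, balancedTensorMap C (P.complex.d (n + 1) n) x = 0 →
        ∃ y, balancedTensorMap C (P.complex.d (n + 2) (n + 1)) y = x := by
  rw [← AddCommGrpCat.isZero_iff_subsingleton, torGroup,
    (P.isoLeftDerivedObj (balancedTensorFunctor C) (n + 1)).isZero_iff]
  change Limits.IsZero (HomologicalComplex.homology _ _) ↔ _
  rw [← HomologicalComplex.exactAt_iff_isZero_homology,
    HomologicalComplex.exactAt_iff' _ (n + 2) (n + 1) n (by simp) (by simp),
    ShortComplex.ab_exact_iff]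
  rfl

/-- Ext-Tor duality `Tor_n(C, M)* ≅ Ext^n(M, C*)`, where `*` is the character dual, in the form
needed here: one side vanishes iff the other does. -/
theorem subsingleton_torGroup_iff_subsingleton_ext (C : ModuleCat.{u} Rᵐᵒᵖ) (M : ModuleCat.{u} R)
    (n : ℕ) : Subsingleton (torGroup (n + 1) C M) ↔
      Subsingleton (Ext M (characterDual C) (n + 1)) := by
  let P := projectiveResolution M
  rw [subsingleton_torGroup_succ_iff P, ext_succ_subsingleton_iff P,
    AddMonoidHom.exact_iff_forall_character]
  constructor
  · intro h f hf
    obtain ⟨χ, hχ⟩ := characterDual.curry_surjective f.hom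
    have hd : χ.comp (balancedTensorMap C (P.complex.d (n + 2) (n + 1))) = 0 := by
      refine characterDual.curry_injective ?_
      rw [characterDual.curry_comp, hχ]
      exact congrArg ModuleCat.Hom.hom hf
    obtain ⟨ψ, rfl⟩ := h χ hd
    exact ⟨ModuleCat.ofHom (Y := characterDual C) (characterDual.curry (M := P.complex.X n) ψ),
      ModuleCat.hom_ext hχ⟩
  · intro h χ hχ
    obtain ⟨g, hg⟩ := h (ModuleCat.ofHom (Y := characterDual C) (characterDual.curry χ))
      (ModuleCat.hom_ext (by
        change characterDual.curry
          (χ.comp (balancedTensorMap C (P.complex.d (n + 2) (n + 1)))) = _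
        rw [hχ]
        rfl))
    obtain ⟨ψ, hψ⟩ := characterDual.curry_surjective g.hom
    refine ⟨ψ, characterDual.curry_injective ?_⟩
    rw [characterDual.curry_comp, hψ]
    exact congrArg ModuleCat.Hom.hom hg

end CharacterDual

/-! ### Character duals over semiprimary rings -/

section CharacterDualSemiprimary

open Abelian MulOpposite

variable {R : Type u} [Ring R] {N : Ideal R}

theorem characterDual.isTorsionBySet {C : ModuleCat.{u} Rᵐᵒᵖ}
    (hC : ∀ a ∈ N, ∀ c : C, op a • c = 0) : Module.IsTorsionBySet R (characterDual C) N :=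
  fun f a => toAddMonoidHom.injective (AddMonoidHom.ext fun c => by
    rw [smul_apply, hC a a.2, map_zero, map_zero, AddMonoidHom.zero_apply])

theorem rightQuotient.op_smul [N.IsTwoSided] (r : R) (c : rightQuotient N) :
    op r • c = (show R ⧸ N from c) * Ideal.Quotient.mk N r :=
  rfl

theorem rightQuotient.op_smul_eq_zero [N.IsTwoSided] {a : R} (ha : a ∈ N)
    (c : rightQuotient N) : op a • c = 0 := by
  rw [op_smul, Ideal.Quotient.eq_zero_iff_mem.2 ha]
  exact mul_zero (M₀ := R ⧸ N) _

theorem IsSimpleModule.op_smul_eq_zero [N.IsTwoSided] (hN : IsNilpotent N) (C : ModuleCat.{u} Rᵐᵒᵖ)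
    [IsSimpleModule Rᵐᵒᵖ C] (a : R) (ha : a ∈ N) (c : C) : op a • c = 0 := by
  refine smul_eq_zero_of_isNilpotent (fun r => ?_) c
  obtain ⟨k, hk⟩ := isNilpotent_of_mem hN (N.mul_mem_right r.unop ha)
  exact ⟨k, unop_injective (by simpa using hk)⟩

theorem isSemisimpleModule_rightQuotient (N : Ideal R) [N.IsTwoSided] [IsSemisimpleRing (R ⧸ N)] :
    IsSemisimpleModule Rᵐᵒᵖ (rightQuotient N) := by
  have : RingHomSurjective (RingHom.op (Ideal.Quotient.mk N)) := ⟨fun x => by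
    obtain ⟨r, hr⟩ := Ideal.Quotient.mk_surjective x.unop
    exact ⟨op r, unop_injective hr⟩⟩
  let f : rightQuotient N →ₛₗ[RingHom.op (Ideal.Quotient.mk N)] (R ⧸ N) :=
    { toFun := id
      map_add' := fun _ _ => rfl
      map_smul' := fun _ _ => rfl }
  exact (LinearMap.isSemisimpleModule_iff_of_bijective f Function.bijective_id).2 inferInstance

/-- The map `f` is only additive, so its kernel need not be a submodule; but `x` is a sum of
elements of simple submodules. -/
theorem IsSemisimpleModule.exists_isSimpleModule_addMonoidHom_ne_zero {S M A : Type*} [Ring S]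
    [AddCommGroup M] [Module S M] [IsSemisimpleModule S M] [AddCommGroup A] (f : M →+ A) {x : M}
    (hx : f x ≠ 0) : ∃ L : Submodule S M, IsSimpleModule S L ∧ ∃ y ∈ L, f y ≠ 0 := by
  by_contra! h
  refine hx ?_
  clear hx
  have hmem : x ∈ ⨆ L : {L : Submodule S M // IsSimpleModule S L}, L.1 := by
    have := IsSemisimpleModule.sSup_simples_eq_top S M
    rw [sSup_eq_iSup'] at this
    exact this.ge Submodule.mem_top
  induction hmem using Submodule.iSup_induction' with
  | mem L y hy => exact h L.1 L.2 y hy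
  | zero => exact map_zero f
  | add y z _ _ hy hz => rw [map_add, hy, hz, add_zero]

/-- Restriction of characters to a submodule of a right module. -/
noncomputable def characterDual.restrict (C : ModuleCat.{u} Rᵐᵒᵖ) (L : Submodule Rᵐᵒᵖ C) :
    characterDual C →ₗ[R] characterDual (ModuleCat.of Rᵐᵒᵖ L) where
  toFun f := toAddMonoidHom.symm ((toAddMonoidHom f).comp L.subtype.toAddMonoidHom)
  map_add' _ _ := rfl
  map_smul' _ _ := rfl

/-- Maps to the character dual of `R ⧸ N` separate the points of a module killed by `N`: a character
`χ` of `M` gives rise to the map sending `m` to `c ↦ χ (c • m)`. -/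
theorem exists_linearMap_characterDual_apply_ne_zero [N.IsTwoSided] {M : ModuleCat.{u} R}
    (hM : Module.IsTorsionBySet R M N) {x : M} (hx : x ≠ 0) :
    ∃ f : M →ₗ[R] characterDual (rightQuotient N),
      ∃ c, characterDual.toAddMonoidHom (f x) c ≠ 0 := by
  let _ := hM.module
  obtain ⟨χ, hχ⟩ := CharacterModule.exists_character_apply_ne_zero_of_ne_zero hx
  let F : M →+ (R ⧸ N) →+ AddCircle (1 : ℚ) := AddMonoidHom.flip
    ((AddMonoidHom.compHom (χ : M →+ AddCircle (1 : ℚ))).comp (smulAddHom (R ⧸ N) M))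
  let f : M →ₗ[R] characterDual (rightQuotient N) :=
    { toFun := fun m => characterDual.toAddMonoidHom.symm (F m)
      map_add' := fun m m' => congrArg characterDual.toAddMonoidHom.symm (F.map_add m m')
      map_smul' := fun r m => characterDual.toAddMonoidHom.injective (AddMonoidHom.ext fun c =>
        congrArg χ (mul_smul (show R ⧸ N from c) (Ideal.Quotient.mk N r) m).symm) }
  refine ⟨f, (1 : R ⧸ N), fun h => hχ ?_⟩
  rw [← h]
  exact congrArg χ (one_smul (R ⧸ N) x).symm

theorem exists_isSimpleModule_linearMap_characterDual_ne_zero [N.IsTwoSided]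
    [IsSemisimpleRing (R ⧸ N)] {M : ModuleCat.{u} R} (hM : Module.IsTorsionBySet R M N) {x : M}
    (hx : x ≠ 0) : ∃ C : ModuleCat.{u} Rᵐᵒᵖ, IsSimpleModule Rᵐᵒᵖ C ∧
      ∃ f : M →ₗ[R] characterDual C, f x ≠ 0 := by
  obtain ⟨f, c, hc⟩ := exists_linearMap_characterDual_apply_ne_zero hM hx
  have := isSemisimpleModule_rightQuotient N
  obtain ⟨L, hL, y, hy, hne⟩ :=
    IsSemisimpleModule.exists_isSimpleModule_addMonoidHom_ne_zero (S := Rᵐᵒᵖ) _ hc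
  refine ⟨ModuleCat.of Rᵐᵒᵖ L, hL, characterDual.restrict _ L ∘ₗ f, fun h => hne ?_⟩
  exact DFunLike.congr_fun (congrArg characterDual.toAddMonoidHom h) (⟨y, hy⟩ : L)

end CharacterDualSemiprimary

/-! ### Testing the Gorenstein global dimension on simple modules -/

theorem mainTheorem3 {R : Type u} [Ring R] (N : Ideal R) [N.IsTwoSided]
    (hN : IsNilpotent N) (hss : IsSemisimpleRing (R ⧸ N))
    (hfin : leftGorensteinGlobalDim R < ⊤) (n : ℕ) (hn : 0 < n) :
    List.TFAE [
      leftGorensteinGlobalDim R < (n : ℕ∞),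
      ∀ I : ModuleCat.{u} R, Module.Injective R I →
        Subsingleton (Abelian.Ext I (ModuleCat.of R (R ⧸ N)) n),
      ∀ I : ModuleCat.{u} R, Module.Injective R I →
        ∀ C : ModuleCat.{u} R, IsSimpleModule R C → Subsingleton (Abelian.Ext I C n),
      ∀ I : ModuleCat.{u} R, Module.Injective R I →
        Subsingleton (torGroup n (rightQuotient N) I),
      ∀ I : ModuleCat.{u} R, Module.Injective R I →
        ∀ C : ModuleCat.{u} Rᵐᵒᵖ, IsSimpleModule Rᵐᵒᵖ C → Subsingleton (torGroup n C I),
      ∀ P : ModuleCat.{u} R, Module.Projective R P →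
        Subsingleton (Abelian.Ext (ModuleCat.of R (R ⧸ N)) P n),
      ∀ P : ModuleCat.{u} R, Module.Projective R P →
        ∀ C : ModuleCat.{u} R, IsSimpleModule R C → Subsingleton (Abelian.Ext C P n)] := by
  have hinj : ∀ I : ModuleCat.{u} R, Module.Injective R I ↔ Injective I := fun I =>
    Module.injective_iff_injective_object R I
  have hproj : ∀ P : ModuleCat.{u} R, Module.Projective R P ↔ Projective P := fun P =>
    IsProjective.iff_projective P
  have hI := leftGorensteinGlobalDim_lt_iff_forall_injective hfin hn
  have hP := leftGorensteinGlobalDim_lt_iff_forall_projective hfin hn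
  obtain ⟨n, rfl⟩ := Nat.exists_eq_succ_of_ne_zero hn.ne'
  rw [Nat.succ_eq_add_one] at *
  simp only [subsingleton_torGroup_iff_subsingleton_ext, hinj, hproj]
  have hItest (h : ∀ I : ModuleCat.{u} R, Injective I → ∀ M : ModuleCat.{u} R,
      Module.IsTorsionBySet R M N → Subsingleton (Abelian.Ext I M (n + 1))) :
      leftGorensteinGlobalDim R < ((n + 1 : ℕ) : ℕ∞) := hI.2 fun I hI =>
    of_isTorsionBySet_of_isNilpotent hN (h I hI) fun S hS _ _ =>
      hS.subsingleton_ext_X₂_right I (n + 1)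
  -- By Ext-Tor duality the two Tor conditions are now about `Ext` with values in character duals.
  tfae_have 1 → 2 := fun h I hI' => hI.1 h I hI' _
  tfae_have 2 → 3 := fun h I hI' C hC => by
    have := h I hI'
    obtain ⟨r⟩ := IsSimpleModule.exists_retract_quotient hN C
    exact subsingleton_ext_of_retract_right r I (n + 1)
  tfae_have 3 → 1 := fun h => hItest fun I hI' M hM =>
    subsingleton_ext_of_separating (N := N) I n fun x hx => by
      have := hM.isSemisimpleModule
      obtain ⟨L, hL, f, hf⟩ :=
        IsSemisimpleModule.exists_isSimpleModule_apply_ne_zero (R := R) hx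
      exact ⟨ModuleCat.of R L, IsSimpleModule.isTorsionBySet hN L, h I hI' _ hL, f, hf⟩
  tfae_have 1 → 4 := fun h I hI' => hI.1 h I hI' _
  tfae_have 4 → 1 := fun h => hItest fun I hI' M hM =>
    subsingleton_ext_of_separating (N := N) I n fun x hx => by
      obtain ⟨f, c, hc⟩ := exists_linearMap_characterDual_apply_ne_zero hM hx
      exact ⟨_, characterDual.isTorsionBySet fun a ha => rightQuotient.op_smul_eq_zero ha,
        h I hI', f, fun h0 => hc (by rw [h0, map_zero, AddMonoidHom.zero_apply])⟩
  tfae_have 1 → 5 := fun h I hI' C _ => hI.1 h I hI' _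
  tfae_have 5 → 1 := fun h => hItest fun I hI' M hM =>
    subsingleton_ext_of_separating (N := N) I n fun x hx => by
      obtain ⟨C, hC, f, hf⟩ := exists_isSimpleModule_linearMap_characterDual_ne_zero hM hx
      exact ⟨_, characterDual.isTorsionBySet (IsSimpleModule.op_smul_eq_zero hN C),
        h I hI' C hC, f, hf⟩
  tfae_have 1 → 6 := fun h P hP' => hP.1 h P hP' _
  tfae_have 6 → 7 := fun h P hP' C hC => by
    have := h P hP'
    obtain ⟨r⟩ := IsSimpleModule.exists_retract_quotient hN C
    exact subsingleton_ext_of_retract_left r P (n + 1)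
  tfae_have 7 → 1 := fun h => hP.2 fun P hP' =>
    of_isTorsionBySet_of_isNilpotent hN (fun M hM => by
      have := hM.isSemisimpleModule
      refine subsingleton_ext_of_sSup_eq_top P n (top_le_iff.1 ?_)
      rw [← IsSemisimpleModule.sSup_simples_eq_top R M]
      exact sSup_le_sSup fun L hL => h P hP' _ hL)
    fun S hS _ _ => hS.subsingleton_ext_X₂_left P (n + 1)
  tfae_finish
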